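/- Fix $C$ entities and measurable kernels $g_1,\dots,g_L\ge 0$ on $\mathbb{R}$. For $\boldsymbol\mu=(\mu_c)\in\mathbb{R}_{\ge0}^{C}$ and $\boldsymbol A=[a_{cc'l}]\in\mathbb{R}_{\ge0}^{C\times C\times L}$, a $C$-type point process on $(0,\infty)$ with counting processes $N=(N_1,\dots,N_C)$ is a Hawkes process, $N\sim HP(\boldsymbol\mu,\boldsymbol A)$, if almost surely no two of its events are simultaneous, every $N_c(t)$ is finite and of finite mean, and, with respect to its own history $\mathcal{H}_t=\sigma(N_c(s):s\le t,\,1\le c\le C)$, $N_c$ has the intensity $$\lambda_c(t)=\frac{\mathbb{E}[dN_c(t)\mid\mathcal{H}_t]}{dt}=\mu_c+\sum_{\text{events }(t_i,c_i),\ t_i<t}\phi_{cc_i}(t-t_i),\qquad \phi_{cc'}=\sum_{l=1}^{L}a_{cc'l}\,g_l,$$ that is, $\mathbb{E}[N_c(t)-N_c(s)\mid\mathcal{H}_s]=\mathbb{E}\bigl[\int_s^t\lambda_c(u)\,du\mid\mathcal{H}_s\bigr]$ for all $0\le s\le t$ and all $c$. For $\boldsymbol U\in\mathbb{R}_{\ge0}^{C\times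 M}$ with columns $\boldsymbol\mu^1,\dots,\boldsymbol\mu^M$, an $M$-agent Hawkes process $HP(\boldsymbol U,\boldsymbol A)$ is a family of independent processes $N^1,\dots,N^M$ with $N^m\sim HP(\boldsymbol\mu^m,\boldsymbol A)$ for each $m$. **Corollary 1.** Let $(N^1,\dots,N^M)$ be an $M$-agent Hawkes process $HP(\boldsymbol U,\boldsymbol A)$, let $\boldsymbol P=[P_{mm'}]\in\{0,1\}^{M\times M'}$, and for $m'=1,\dots,M'$ let $$\widetilde N^{m'}(t)=\sum_{m:\,P_{mm'}=1}N^m(t)$$ be the superposition of the processes indicated by the ones in the $m'$-th column of $\boldsymbol P$. Then, for every $m'$, $\widetilde N^{m'}$ is a Hawkes process $HP(\boldsymbol\mu'^{m'},\boldsymbol A)$, where $\boldsymbol\mu'^{m'}$ is the $m'$-th column of $\boldsymbol U'=\boldsymbol U\boldsymbol P$. Moreover, if no source process is used in more than one superposition (each row of $\boldsymbol P$ contains at most one $1$), then $(\widetilde N^1,\dots,\widetilde N^{M'})$ is an $M'$-agent Hawkes process $HP(\boldsymbol U\boldsymbol P,\boldsymbol A)$; in particular its agents are independent. -/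

import Mathlib

open MeasureTheory ProbabilityTheory Set
open scoped NNReal ENNReal

noncomputable section

namespace Hawkes

/-- A point process on `(0, ∞)` whose events carry a type (entity) `c ∈ Fin C`, given by its random
counting measures: `N.meas c ω B` is the number of type-`c` events in `B`. The counting process
`N_c(t)` is finite and integer valued, and no event occurs up to time `0`. -/
structure CountingProcess (C : ℕ) (Ω : Type*) [MeasurableSpace Ω] where
  /-- the counting measure of the type-`c` events -/
  meas : Fin C → Ω → Measure ℝ
  measurable_meas : ∀ c, Measurable (meas c)
  zero : ∀ c ω, meas c ω (Iic 0) = 0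
  nat : ∀ c ω t, ∃ k : ℕ, meas c ω (Iic t) = k

variable {Ω : Type*} [MeasurableSpace Ω] {C L M : ℕ}

/-- The counting process `N_c(t)`, the number of type-`c` events up to time `t`. -/
def CountingProcess.count (N : CountingProcess C Ω) (c : Fin C) (t : ℝ) (ω : Ω) : ℝ≥0∞ :=
  N.meas c ω (Iic t)

/-- The history up to time `t`: the σ-algebra generated by all `N_c(s)` with `s ≤ t`. -/
abbrev CountingProcess.history (N : CountingProcess C Ω) (t : ℝ) : MeasurableSpace Ω :=
  ⨆ (c : Fin C) (s : Iic t), MeasurableSpace.comap (N.count c s) inferInstance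

/-- The superposition of the processes `N m`, `m ∈ S`: the sum of their counting processes. -/
def superpose (N : Fin M → CountingProcess C Ω) (S : Finset (Fin M)) : CountingProcess C Ω where
  meas c ω := ∑ m ∈ S, (N m).meas c ω
  measurable_meas c := by
    refine Measure.measurable_of_measurable_coe _ fun B hB => ?_
    simp only [Measure.finsetSum_apply]
    exact Finset.measurable_fun_sum S fun m _ =>
      (Measure.measurable_coe hB).comp ((N m).measurable_meas c)
  zero c ω := by simp [(N _).zero c ω]
  nat c ω t := by
    choose k hk using fun m => (N m).nat c ω t
    exact ⟨∑ m ∈ S, k m, by simp [hk]⟩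

/-- The impact function `φ_{cc'}(x) = ∑ₗ a_{cc'l} g_l(x)`. -/
def impact (A : Fin C → Fin C → Fin L → ℝ≥0) (g : Fin L → ℝ → ℝ≥0) (c c' : Fin C) (x : ℝ) : ℝ≥0 :=
  ∑ l, A c c' l * g l x

/-- The Hawkes intensity `λ_c(t) = μ_c + ∑_{(t_i, c_i), t_i < t} φ_{c c_i}(t - t_i)`; the sum over
past events of type `c'` is the integral against their counting measure. -/
def intensity (μ : Fin C → ℝ≥0) (A : Fin C → Fin C → Fin L → ℝ≥0) (g : Fin L → ℝ → ℝ≥0)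
    (N : CountingProcess C Ω) (c : Fin C) (t : ℝ) (ω : Ω) : ℝ≥0∞ :=
  μ c + ∑ c', ∫⁻ s in Iio t, (impact A g c c' (t - s) : ℝ≥0∞) ∂(N.meas c' ω)

/-- `N ∼ HP(μ, A)` under `Pr`, with kernels `g`: almost surely no two events are simultaneous,
`N_c(t)` has finite mean, and `𝔼[dN_c(t) | H_t] = λ_c(t) dt` for the Hawkes intensity `λ_c` and the
history `H_t` of `N` itself, that is, `𝔼[N_c(t) - N_c(s) | H_s] = 𝔼[∫ₛᵗ λ_c(u) du | H_s]` for
`0 ≤ s ≤ t` (both sides having the same integral over every event `E ∈ H_s`). -/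
structure IsHawkes (Pr : Measure Ω) (g : Fin L → ℝ → ℝ≥0) (N : CountingProcess C Ω)
    (μ : Fin C → ℝ≥0) (A : Fin C → Fin C → Fin L → ℝ≥0) : Prop where
  simple : ∀ᵐ ω ∂Pr, ∀ t : ℝ, ∑ c, N.meas c ω {t} ≤ 1
  finite_mean : ∀ c t, ∫⁻ ω, N.count c t ω ∂Pr < ∞
  hasIntensity : ∀ (c : Fin C) (s t : ℝ), 0 ≤ s → s ≤ t → ∀ E : Set Ω, MeasurableSet[N.history s] E →
    ∫⁻ ω in E, (N.count c t ω - N.count c s ω) ∂Pr =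
      ∫⁻ ω in E, (∫⁻ u in Ioc s t, intensity μ A g N c u ω) ∂Pr

/-- `N = (N^1, …, N^M)` is an `M`-agent Hawkes process `HP(U, A)` under `Pr`, with kernels `g`:
the agents' processes are independent and `N^m ∼ HP(μ^m, A)`, where `μ^m` is the `m`-th column
of `U`. -/
structure IsMultiAgentHawkes (Pr : Measure Ω) (g : Fin L → ℝ → ℝ≥0)
    (N : Fin M → CountingProcess C Ω) (U : Matrix (Fin C) (Fin M) ℝ≥0)
    (A : Fin C → Fin C → Fin L → ℝ≥0) : Prop where
  indep : iIndepFun (fun (m : Fin M) (ω : Ω) (c : Fin C) => (N m).meas c ω) Pr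
  hawkes : ∀ m, IsHawkes Pr g (N m) (fun c => U c m) A

end Hawkes

end

open Hawkes

open scoped Topology

/-! Since all agents share the same impact functions and the impact term is an integral against the
counting measures, intensities add under superposition, the base rates adding to a column of `U * P`
(`intensity_superpose`). Two points need the independence of the agents.

The intensity must refer to the history of the superposition. Each agent keeps its intensity when
its own history is enlarged by independent information (`setLIntegral_eq_of_indep`), hence with
respect to the joint history of all agents; summing and passing to the coarser history of the
superposition gives the claim.

Events of different agents must not coincide. The mean number of events in `Ioc s t` is the integral
of the mean intensity, which tends to 0 as `s` increases to `t`, so there are no fixed atoms; by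
independence and Tonelli, two agents then almost surely share no atom.

Joint independence of the superpositions is grouping of independent σ-algebras over disjoint index
sets. -/

namespace Hawkes

/-! ### Random measures as s-finite kernels; common atoms -/

section Kernel

variable {α : Type*} [MeasurableSpace α]

/-- A finite kernel needs a uniform mass bound, so the source is split by the integer part of the
total mass. -/
lemma isSFiniteKernel_of_forall_isFiniteMeasure {β : Type*} [MeasurableSpace β] (κ : Kernel α β)
    (h : ∀ a, κ a univ < ∞) : IsSFiniteKernel κ := by
  have hm : Measurable fun a => ⌊(κ a univ).toReal⌋₊ :=
    Nat.measurable_floor.comp (κ.measurable_coe .univ).ennreal_toReal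
  have hs : ∀ k : ℕ, MeasurableSet ((fun a => ⌊(κ a univ).toReal⌋₊) ⁻¹' {k}) := fun k =>
    hm (measurableSet_singleton k)
  classical
  have hκ : κ = Kernel.sum fun k => Kernel.piecewise (hs k) κ 0 := by
    ext a B hB
    rw [Kernel.sum_apply' _ _ hB, tsum_eq_single ⌊(κ a univ).toReal⌋₊]
    · simp [Kernel.piecewise_apply]
    · intro k hk
      simp [Kernel.piecewise_apply, hk.symm]
  rw [hκ]
  have (k : ℕ) : IsFiniteKernel (Kernel.piecewise (hs k) κ 0) := by
    refine ⟨⟨k + 1, by finiteness, fun a => ?_⟩⟩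
    rw [Kernel.piecewise_apply]
    split_ifs with ha
    · have h1 := (Nat.lt_floor_add_one (κ a univ).toReal).le
      rw [mem_preimage, mem_singleton_iff] at ha
      rw [ha] at h1
      rw [← ENNReal.ofReal_toReal (h a).ne]
      refine (ENNReal.ofReal_le_ofReal h1).trans_eq ?_
      rw [ENNReal.ofReal_add (by positivity) zero_le_one]
      simp
    · simp
  infer_instance

/-- Cutting the line into the disjoint increments of `Iic n` reduces to finite measures. This makes
Tonelli available for integrals against a random counting measure. -/
lemma isSFiniteKernel_of_forall_Iic_lt_top (κ : Kernel α ℝ)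
    (h : ∀ a (n : ℕ), κ a (Iic (n : ℝ)) < ∞) : IsSFiniteKernel κ := by
  have hm : ∀ n, MeasurableSet (disjointed (fun n : ℕ => Iic (n : ℝ)) n) :=
    MeasurableSet.disjointed fun n => measurableSet_Iic
  have hU : ⋃ n, disjointed (fun n : ℕ => Iic (n : ℝ)) n = univ := by
    rw [iUnion_disjointed, iUnion_eq_univ_iff]
    exact fun x => exists_nat_ge x
  have hκ : κ = Kernel.sum fun n => Kernel.restrict κ (hm n) := by
    ext a B hB
    rw [Kernel.sum_apply' _ _ hB]
    simp_rw [Kernel.restrict_apply' _ _ _ hB]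
    rw [← measure_iUnion (fun i j hij => ((disjoint_disjointed _ hij).mono
      inter_subset_right inter_subset_right)) (fun i => hB.inter (hm i)), ← inter_iUnion, hU,
      inter_univ]
  rw [hκ]
  have (n : ℕ) : IsSFiniteKernel (Kernel.restrict κ (hm n)) := by
    refine isSFiniteKernel_of_forall_isFiniteMeasure _ fun a => ?_
    rw [Kernel.restrict_apply, Measure.restrict_apply_univ]
    exact (measure_mono (disjointed_subset _ n)).trans_lt (h a n)
  infer_instance

lemma measurableSet_forall_Iic_lt_top :
    MeasurableSet {ν : Measure ℝ | ∀ n : ℕ, ν (Iic (n : ℝ)) < ∞} := by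
  simp only [ofPred_forall]
  exact MeasurableSet.iInter fun n =>
    measurableSet_lt (Measure.measurable_coe measurableSet_Iic) measurable_const

open scoped Classical in
/-- The identity on the measures that are finite on all `Iic n`, and zero elsewhere. -/
noncomputable def locFinite : Kernel (Measure ℝ) ℝ :=
  Kernel.piecewise measurableSet_forall_Iic_lt_top ⟨id, measurable_id⟩ 0

lemma locFinite_apply {ν : Measure ℝ} (h : ∀ n : ℕ, ν (Iic (n : ℝ)) < ∞) : locFinite ν = ν := by
  classical
  rw [locFinite, Kernel.piecewise_apply, if_pos (by exact h)]
  rfl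

instance : IsSFiniteKernel locFinite := by
  refine isSFiniteKernel_of_forall_Iic_lt_top _ fun ν n => ?_
  classical
  rw [locFinite, Kernel.piecewise_apply]
  split_ifs with h
  · exact h n
  · simp

lemma measurable_locFinite_singleton :
    Measurable fun p : Measure ℝ × ℝ => locFinite p.1 {p.2} := by
  have hs : MeasurableSet {q : (Measure ℝ × ℝ) × ℝ | q.2 = q.1.2} :=
    measurableSet_eq_fun measurable_snd (measurable_snd.comp measurable_fst)
  exact Kernel.measurable_kernel_prodMk_left
    (κ := locFinite.comap (Prod.fst : Measure ℝ × ℝ → Measure ℝ) measurable_fst) hs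

lemma measurable_locFinite_lintegral {f : ℝ → ℝ≥0∞} (hf : Measurable f) :
    Measurable fun p : Measure ℝ × ℝ => ∫⁻ s in Iio p.2, f (p.2 - s) ∂(locFinite p.1) := by
  have hs : MeasurableSet {q : (Measure ℝ × ℝ) × ℝ | q.2 < q.1.2} :=
    measurableSet_lt measurable_snd (measurable_snd.comp measurable_fst)
  have hF : Measurable fun q : (Measure ℝ × ℝ) × ℝ => f (q.1.2 - q.2) := by fun_prop
  have := (hF.indicator hs).lintegral_kernel_prod_right'
    (κ := locFinite.comap (Prod.fst : Measure ℝ × ℝ → Measure ℝ) measurable_fst)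
  convert this using 2 with p
  rw [← lintegral_indicator measurableSet_Iio]
  rfl

/-- Two independent locally finite random measures have almost surely no atom in common when the
second one has no fixed atom. -/
lemma ae_forall_singleton_eq_zero_or {Ω : Type*} [MeasurableSpace Ω] {Pr : Measure Ω}
    [IsProbabilityMeasure Pr] {X Y : Ω → Measure ℝ} (hX : Measurable X) (hY : Measurable Y)
    (hXY : IndepFun X Y Pr) (hXf : ∀ ω (n : ℕ), X ω (Iic (n : ℝ)) < ∞)
    (hYf : ∀ ω (n : ℕ), Y ω (Iic (n : ℝ)) < ∞) (h : ∀ t, ∫⁻ ω, Y ω {t} ∂Pr = 0) :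
    ∀ᵐ ω ∂Pr, ∀ t, X ω {t} = 0 ∨ Y ω {t} = 0 := by
  have hG : Measurable fun q : (Measure ℝ × Measure ℝ) × ℝ => locFinite q.1.2 {q.2} :=
    measurable_locFinite_singleton.comp
      ((measurable_snd.comp measurable_fst).prodMk measurable_snd)
  have hF : Measurable fun p : Measure ℝ × Measure ℝ =>
      ∫⁻ t, locFinite p.2 {t} ∂(locFinite p.1) :=
    hG.lintegral_kernel_prod_right'
      (κ := locFinite.comap (Prod.fst : Measure ℝ × Measure ℝ → Measure ℝ) measurable_fst)
  have hPX := Measure.isProbabilityMeasure_map (μ := Pr) hX.aemeasurable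
  have hPY := Measure.isProbabilityMeasure_map (μ := Pr) hY.aemeasurable
  -- The integral weighs the atoms of `Y` by `X`; under the product law the `Y`-mean can be taken
  -- first, and it vanishes at every fixed `t`.
  have hzero : ∫⁻ ω, ∫⁻ t, Y ω {t} ∂(X ω) ∂Pr = 0 := by
    calc ∫⁻ ω, ∫⁻ t, Y ω {t} ∂(X ω) ∂Pr
        = ∫⁻ ω, ∫⁻ t, locFinite (Y ω) {t} ∂(locFinite (X ω)) ∂Pr := by
          simp_rw [locFinite_apply (hXf _), locFinite_apply (hYf _)]
      _ = ∫⁻ p, ∫⁻ t, locFinite p.2 {t} ∂(locFinite p.1) ∂(Pr.map fun ω => (X ω, Y ω)) := by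
          rw [lintegral_map hF (hX.prodMk hY)]
      _ = ∫⁻ ν, ∫⁻ ν', ∫⁻ t, locFinite ν' {t} ∂(locFinite ν) ∂(Pr.map Y) ∂(Pr.map X) := by
          rw [hXY.map_prod_eq_prod_map_map hX.aemeasurable hY.aemeasurable,
            lintegral_prod _ hF.aemeasurable]
      _ = ∫⁻ ν, ∫⁻ t, ∫⁻ ν', locFinite ν' {t} ∂(Pr.map Y) ∂(locFinite ν) ∂(Pr.map X) := by
          congr with ν
          exact lintegral_lintegral_swap measurable_locFinite_singleton.aemeasurable
      _ = 0 := by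
          have (t : ℝ) : ∫⁻ ν', locFinite ν' {t} ∂(Pr.map Y) = 0 := by
            rw [lintegral_map (locFinite.measurable_coe (measurableSet_singleton t)) hY, ← h t]
            simp_rw [locFinite_apply (hYf _)]
          simp [this]
  have hm : Measurable fun ω => ∫⁻ t, Y ω {t} ∂(X ω) := by
    convert hF.comp (hX.prodMk hY) using 2 with ω
    simp [locFinite_apply (hXf _), locFinite_apply (hYf _)]
  filter_upwards [(lintegral_eq_zero_iff hm).1 hzero] with ω hω t
  have h1 : Y ω {t} * X ω {t} ≤ ∫⁻ t, Y ω {t} ∂(X ω) := by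
    rw [← lintegral_singleton (fun t => Y ω {t})]
    exact setLIntegral_le_lintegral _ _
  rw [hω] at h1
  exact (mul_eq_zero.1 (le_antisymm h1 zero_le)).symm

end Kernel

/-! ### Independence of σ-algebras and enlargement of the history -/

section Indep

variable {Ω : Type*} [mΩ : MeasurableSpace Ω] {Pr : Measure Ω}

/-- Suprema of independent σ-algebras over pairwise disjoint sets of indices are independent. -/
lemma iIndep_biSup_of_pairwise_disjoint {ι κ : Type*} {m : ι → MeasurableSpace Ω}
    (hle : ∀ i, m i ≤ mΩ) (h : iIndep m Pr) {S : κ → Set ι}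
    (hS : Pairwise fun j k => Disjoint (S j) (S k)) [IsProbabilityMeasure Pr] :
    iIndep (fun k => ⨆ i ∈ S k, m i) Pr := by
  classical
  rw [iIndep_iff]
  intro s
  induction s using Finset.induction_on with
  | empty => simp
  | insert a s ha ih =>
    intro f hf
    rw [Finset.set_biInter_insert, Finset.prod_insert ha,
      ← ih fun i hi => hf i (Finset.mem_insert_of_mem hi)]
    have hd : Disjoint (S a) (⋃ k ∈ s, S k) := by
      simp only [disjoint_iUnion_right]
      exact fun k hk => hS (ne_of_mem_of_not_mem hk ha).symm
    refine (Indep_iff _ _ _).1 (indep_iSup_of_disjoint hle h hd) _ _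
      (hf a (Finset.mem_insert_self a s)) ?_
    refine Finset.measurableSet_biInter _ fun k hk => ?_
    refine (biSup_mono fun i hi => ?_ : (⨆ i ∈ S k, m i) ≤ _) _
      (hf k (Finset.mem_insert_of_mem hk))
    exact mem_biUnion hk hi

/-- Equality of integrals over the events of a σ-algebra `H` extends to the events of `H ⊔ G`
when `G` is independent of the integrands and of `H`. -/
lemma setLIntegral_eq_of_indep {m H G : MeasurableSpace Ω} (hm : m ≤ mΩ) (hG : G ≤ mΩ) (hH : H ≤ m)
    (hind : Indep m G Pr) {f g : Ω → ℝ≥0∞} (hf : Measurable[m] f) (hg : Measurable[m] g)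
    (hfin : ∫⁻ ω, f ω ∂Pr ≠ ∞)
    (h : ∀ E, MeasurableSet[H] E → ∫⁻ ω in E, f ω ∂Pr = ∫⁻ ω in E, g ω ∂Pr)
    {E : Set Ω} (hE : MeasurableSet[H ⊔ G] E) :
    ∫⁻ ω in E, f ω ∂Pr = ∫⁻ ω in E, g ω ∂Pr := by
  -- On a rectangle `A ∩ B` independence factors out `Pr B`; these rectangles form a π-system
  -- generating `H ⊔ G`.
  have key : ∀ {F : Ω → ℝ≥0∞}, Measurable[m] F → ∀ {A B}, MeasurableSet[H] A → MeasurableSet[G] B →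
      ∫⁻ ω in A ∩ B, F ω ∂Pr = (∫⁻ ω in A, F ω ∂Pr) * Pr B := by
    intro F hF A B hA hB
    rw [← lintegral_indicator (hm _ (hH _ hA)), ← lintegral_indicator
      ((hm _ (hH _ hA)).inter (hG _ hB)), ← lintegral_indicator_one (hG _ hB),
      ← lintegral_mul_eq_lintegral_mul_lintegral_of_independent_measurableSpace hm hG hind
        (hF.indicator (hH _ hA)) (measurable_one.indicator hB)]
    congr with ω
    by_cases h1 : ω ∈ A <;> by_cases h2 : ω ∈ B <;> simp [h1, h2]
  have huniv : ∫⁻ ω, f ω ∂Pr = ∫⁻ ω, g ω ∂Pr := by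
    simpa using h univ MeasurableSet.univ
  have hgen : H ⊔ G = MeasurableSpace.generateFrom
      (image2 (· ∩ ·) {A | MeasurableSet[H] A} {B | MeasurableSet[G] B}) := by
    apply le_antisymm
    · refine sup_le (fun A hA => ?_) fun B hB => ?_
      · exact MeasurableSpace.measurableSet_generateFrom
          ⟨A, hA, univ, MeasurableSet.univ, inter_univ A⟩
      · exact MeasurableSpace.measurableSet_generateFrom
          ⟨univ, MeasurableSet.univ, B, hB, univ_inter B⟩
    · refine MeasurableSpace.generateFrom_le ?_
      rintro _ ⟨A, hA, B, hB, rfl⟩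
      exact @MeasurableSet.inter _ (H ⊔ G) _ _ ((le_sup_left : H ≤ H ⊔ G) _ hA)
        ((le_sup_right : G ≤ H ⊔ G) _ hB)
  have hle : H ⊔ G ≤ mΩ := sup_le (hH.trans hm) hG
  have hpi : IsPiSystem (image2 (· ∩ ·) {A | MeasurableSet[H] A} {B | MeasurableSet[G] B}) := by
    rintro _ ⟨A, hA, B, hB, rfl⟩ _ ⟨A', hA', B', hB', rfl⟩ -
    exact ⟨A ∩ A', @MeasurableSet.inter _ H _ _ hA hA', B ∩ B', @MeasurableSet.inter _ G _ _ hB hB',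
      inter_inter_inter_comm _ _ _ _⟩
  refine MeasurableSpace.induction_on_inter (m := H ⊔ G)
    (C := fun E _ => ∫⁻ ω in E, f ω ∂Pr = ∫⁻ ω in E, g ω ∂Pr) hgen hpi (by simp) ?_ ?_ ?_ E hE
  · rintro _ ⟨A, hA, B, hB, rfl⟩
    rw [key hf hA hB, key hg hA hB, h A hA]
  -- Complements require subtraction, hence finite integrals.
  · intro t ht heq
    rw [setLIntegral_compl (hle _ ht), setLIntegral_compl (hle _ ht), heq, huniv]
    · exact ((setLIntegral_le_lintegral _ _).trans_lt (huniv ▸ hfin.lt_top)).ne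
    · exact ((setLIntegral_le_lintegral _ _).trans_lt hfin.lt_top).ne
  · intro F hFd hFm hF
    simp_rw [lintegral_iUnion (fun i => hle _ (hFm i)) hFd, hF]

end Indep

/-! ### Measurability of counts, histories and intensities -/

section CountingProcess

variable {Ω : Type*} [MeasurableSpace Ω] {C L M : ℕ}

namespace CountingProcess

variable (N : CountingProcess C Ω)

lemma count_lt_top (c : Fin C) (t : ℝ) (ω : Ω) : N.meas c ω (Iic t) < ∞ := by
  obtain ⟨k, hk⟩ := N.nat c ω t
  simp [hk]

lemma count_sub_count (c : Fin C) {s t : ℝ} (hst : s ≤ t) (ω : Ω) :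
    N.count c t ω - N.count c s ω = N.meas c ω (Ioc s t) := by
  rw [count, count, ← Iic_sdiff_Iic, measure_sdiff (Iic_subset_Iic.2 hst)
    measurableSet_Iic.nullMeasurableSet (N.count_lt_top c s ω).ne]

/-- The σ-algebra generated by the whole process. -/
abbrev sigmaAlgebra : MeasurableSpace Ω :=
  MeasurableSpace.comap (fun ω c => N.meas c ω) inferInstance

lemma sigmaAlgebra_le : N.sigmaAlgebra ≤ ‹MeasurableSpace Ω› :=
  (measurable_pi_lambda _ N.measurable_meas).comap_le

lemma measurable_meas_apply {c : Fin C} {B : Set ℝ} (hB : MeasurableSet B) :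
    Measurable[N.sigmaAlgebra] fun ω => N.meas c ω B :=
  Measurable.comp (g := fun ν : Fin C → Measure ℝ => ν c B)
    ((Measure.measurable_coe hB).comp (measurable_pi_apply c))
    (comap_measurable fun ω c => N.meas c ω)

lemma measurable_meas_coe {c : Fin C} {B : Set ℝ} (hB : MeasurableSet B) :
    Measurable fun ω => N.meas c ω B :=
  (N.measurable_meas_apply hB).mono N.sigmaAlgebra_le le_rfl

lemma history_le (t : ℝ) : N.history t ≤ N.sigmaAlgebra :=
  iSup₂_le fun _ _ => (N.measurable_meas_apply measurableSet_Iic).comap_le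

end CountingProcess

variable {μ : Fin C → ℝ≥0} {A : Fin C → Fin C → Fin L → ℝ≥0} {g : Fin L → ℝ → ℝ≥0}

/-- The intensity is one fixed measurable functional of the path and time. This yields both joint
measurability and measurability with respect to the σ-algebra of the process itself. -/
lemma exists_measurable_intensity_eq (hg : ∀ l, Measurable (g l)) (μ : Fin C → ℝ≥0)
    (A : Fin C → Fin C → Fin L → ℝ≥0) (c : Fin C) :
    ∃ G : (Fin C → Measure ℝ) × ℝ → ℝ≥0∞, Measurable G ∧
      ∀ (N : CountingProcess C Ω) u ω, intensity μ A g N c u ω = G (fun c' => N.meas c' ω, u) := by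
  refine ⟨fun p => μ c + ∑ c', ∫⁻ s in Iio p.2, (impact A g c c' (p.2 - s) : ℝ≥0∞)
    ∂(locFinite (p.1 c')), ?_, fun N u ω => ?_⟩
  · refine Measurable.const_add (Finset.measurable_fun_sum _ fun c' _ => ?_) _
    have hφ : Measurable fun x => (impact A g c c' x : ℝ≥0∞) := by
      unfold impact
      fun_prop
    have hp : Measurable fun p : (Fin C → Measure ℝ) × ℝ => (p.1 c', p.2) :=
      ((measurable_pi_apply c').comp measurable_fst).prodMk measurable_snd
    exact (measurable_locFinite_lintegral hφ).comp hp
  · simp only [intensity]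
    simp_rw [locFinite_apply fun n : ℕ => N.count_lt_top _ n ω]

lemma measurable_intensity (hg : ∀ l, Measurable (g l)) (N : CountingProcess C Ω) (c : Fin C) :
    Measurable fun p : Ω × ℝ => intensity μ A g N c p.2 p.1 := by
  obtain ⟨G, hG, h⟩ := exists_measurable_intensity_eq (Ω := Ω) hg μ A c
  simp_rw [h]
  exact hG.comp (((measurable_pi_lambda _ N.measurable_meas).comp measurable_fst).prodMk
    measurable_snd)

lemma measurable_setLIntegral_intensity (hg : ∀ l, Measurable (g l)) (N : CountingProcess C Ω)
    (c : Fin C) (B : Set ℝ) :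
    Measurable[N.sigmaAlgebra] fun ω => ∫⁻ u in B, intensity μ A g N c u ω := by
  obtain ⟨G, hG, h⟩ := exists_measurable_intensity_eq (Ω := Ω) hg μ A c
  simp_rw [h]
  exact (hG.lintegral_prod_right' (ν := volume.restrict B)).comp
    (comap_measurable fun ω c => N.meas c ω)

/-! ### Absence of fixed atoms -/

namespace IsHawkes

variable {Pr : Measure Ω} {N : CountingProcess C Ω}

lemma lintegral_meas_Ioc (hN : IsHawkes Pr g N μ A) (c : Fin C) {s t : ℝ} (hs : 0 ≤ s)
    (hst : s ≤ t) :
    ∫⁻ ω, N.meas c ω (Ioc s t) ∂Pr =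
      ∫⁻ ω, (∫⁻ u in Ioc s t, intensity μ A g N c u ω) ∂Pr := by
  have := hN.hasIntensity c s t hs hst univ MeasurableSet.univ
  simpa only [setLIntegral_univ, N.count_sub_count c hst] using this

lemma lintegral_meas_Ioc_lt_top (hN : IsHawkes Pr g N μ A) (c : Fin C) (s t : ℝ) :
    ∫⁻ ω, N.meas c ω (Ioc s t) ∂Pr < ∞ :=
  (lintegral_mono fun _ => measure_mono Ioc_subset_Iic_self).trans_lt (hN.finite_mean c t)

/-- A Hawkes process has no fixed atom. -/
lemma lintegral_meas_singleton [SFinite Pr] (hg : ∀ l, Measurable (g l))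
    (hN : IsHawkes Pr g N μ A) (c : Fin C) (t : ℝ) : ∫⁻ ω, N.meas c ω {t} ∂Pr = 0 := by
  -- The intensity identity only covers times `≥ 0`; up to time 0 there are no events at all.
  rcases le_or_gt t 0 with ht | ht
  · have (ω : Ω) : N.meas c ω {t} = 0 :=
      measure_mono_null (singleton_subset_iff.2 (mem_Iic.2 ht)) (N.zero c ω)
    simp [this]
  have hswap (s : ℝ) : ∫⁻ ω, (∫⁻ u in Ioc s t, intensity μ A g N c u ω) ∂Pr =
      ∫⁻ u in Ioc s t, ∫⁻ ω, intensity μ A g N c u ω ∂Pr :=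
    lintegral_lintegral_swap (measurable_intensity hg N c).aemeasurable
  have hfin : ∫⁻ u in Ioc 0 t, ∫⁻ ω, intensity μ A g N c u ω ∂Pr ≠ ∞ := by
    rw [← hswap, ← hN.lintegral_meas_Ioc c le_rfl ht.le]
    exact (hN.lintegral_meas_Ioc_lt_top c 0 t).ne
  -- Absolute continuity of the finite integral `hfin` sends the integral over `Ioc s t` to 0; it
  -- bounds the mean mass at `t`.
  have hvol : Filter.Tendsto (fun s => volume.restrict (Ioc 0 t) (Ioc s t)) (𝓝[<] t) (𝓝 0) := by
    have h1 : Filter.Tendsto (fun s : ℝ => ENNReal.ofReal (t - s)) (𝓝[<] t) (𝓝 0) := by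
      have : Continuous fun s : ℝ => ENNReal.ofReal (t - s) :=
        ENNReal.continuous_ofReal.comp (by fun_prop)
      simpa using (this.tendsto t).mono_left nhdsWithin_le_nhds
    refine tendsto_of_tendsto_of_tendsto_of_le_of_le tendsto_const_nhds h1 (fun _ => zero_le)
      fun s => ?_
    exact (Measure.restrict_apply_le _ _).trans_eq Real.volume_Ioc
  refine le_antisymm (ge_of_tendsto (tendsto_setLIntegral_zero hfin hvol) ?_) zero_le
  filter_upwards [Ioo_mem_nhdsLT ht] with s hs
  rw [Measure.restrict_restrict measurableSet_Ioc,
    inter_eq_left.2 (Ioc_subset_Ioc_left hs.1.le), ← hswap,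
    ← hN.lintegral_meas_Ioc c hs.1.le hs.2.le]
  exact lintegral_mono fun ω => measure_mono (singleton_subset_iff.2 ⟨hs.2, le_rfl⟩)

end IsHawkes

/-! ### Superposition -/

lemma superpose_meas (N : Fin M → CountingProcess C Ω) (S : Finset (Fin M)) (c : Fin C) (ω : Ω) :
    (superpose N S).meas c ω = ∑ m ∈ S, (N m).meas c ω := rfl

lemma restrict_finsetSum {α ι : Type*} [MeasurableSpace α] (s : Finset ι) (ν : ι → Measure α)
    (B : Set α) : (∑ i ∈ s, ν i).restrict B = ∑ i ∈ s, (ν i).restrict B :=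
  map_sum (Measure.restrictₗ B) ν s

lemma intensity_superpose (μ : Fin M → Fin C → ℝ≥0) (N : Fin M → CountingProcess C Ω)
    (S : Finset (Fin M)) (c : Fin C) (u : ℝ) (ω : Ω) :
    intensity (fun c => ∑ m ∈ S, μ m c) A g (superpose N S) c u ω =
      ∑ m ∈ S, intensity (μ m) A g (N m) c u ω := by
  simp only [intensity, Finset.sum_add_distrib]
  rw [Finset.sum_comm]
  simp_rw [superpose_meas, restrict_finsetSum, lintegral_finsetSum_measure]
  push_cast
  rfl

lemma history_superpose_le (N : Fin M → CountingProcess C Ω) (S : Finset (Fin M)) (t : ℝ) :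
    (superpose N S).history t ≤ ⨆ m ∈ S, (N m).history t := by
  refine iSup₂_le fun c s => Measurable.comap_le ?_
  have : (superpose N S).count c s = fun ω => ∑ m ∈ S, (N m).count c s ω := by
    ext ω
    simp [CountingProcess.count, superpose_meas]
  rw [this]
  refine Finset.measurable_fun_sum S fun m hm => ?_
  refine Measurable.mono (Measurable.of_comap_le ?_ : Measurable[(N m).history t] _)
    (le_biSup (fun m => (N m).history t) hm) le_rfl
  exact le_iSup₂ (f := fun (c : Fin C) (s : Iic t) =>
    MeasurableSpace.comap ((N m).count c s) inferInstance) c s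

namespace IsMultiAgentHawkes

variable {Pr : Measure Ω} {N : Fin M → CountingProcess C Ω}
  {U : Matrix (Fin C) (Fin M) ℝ≥0}

lemma iIndep_sigmaAlgebra (hN : IsMultiAgentHawkes Pr g N U A) :
    iIndep (fun m => (N m).sigmaAlgebra) Pr :=
  (iIndepFun_iff_iIndep _ _ _).1 hN.indep

lemma ae_superpose_singleton_le_one [IsProbabilityMeasure Pr] (hg : ∀ l, Measurable (g l))
    (hN : IsMultiAgentHawkes Pr g N U A) (S : Finset (Fin M)) :
    ∀ᵐ ω ∂Pr, ∀ t : ℝ, ∑ c, (superpose N S).meas c ω {t} ≤ 1 := by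
  have hpair : ∀ m m', m ≠ m' → ∀ c c', ∀ᵐ ω ∂Pr, ∀ t,
      (N m).meas c ω {t} = 0 ∨ (N m').meas c' ω {t} = 0 := fun m m' hmm' c c' =>
    ae_forall_singleton_eq_zero_or ((N m).measurable_meas c) ((N m').measurable_meas c')
      ((hN.indep.indepFun hmm').comp (measurable_pi_apply c) (measurable_pi_apply c'))
      (fun ω n => (N m).count_lt_top c n ω) (fun ω n => (N m').count_lt_top c' n ω)
      ((hN.hawkes m').lintegral_meas_singleton hg c')
  have hall : ∀ᵐ ω ∂Pr, ∀ m m', m ≠ m' → ∀ c c', ∀ t,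
      (N m).meas c ω {t} = 0 ∨ (N m').meas c' ω {t} = 0 := by
    simpa only [ae_all_iff] using hpair
  have hsimple : ∀ᵐ ω ∂Pr, ∀ m, ∀ t : ℝ, ∑ c, (N m).meas c ω {t} ≤ 1 :=
    ae_all_iff.2 fun m => (hN.hawkes m).simple
  filter_upwards [hall, hsimple] with ω h1 h2 t
  simp_rw [superpose_meas, Measure.finsetSum_apply]
  rw [Finset.sum_comm]
  -- If one agent has an event at `t`, no other does, so only its own simplicity matters.
  by_cases h : ∃ m ∈ S, ∃ c, (N m).meas c ω {t} ≠ 0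
  · obtain ⟨m, hm, c, hc⟩ := h
    rw [Finset.sum_eq_single_of_mem m hm]
    · exact h2 m t
    · intro m' _ hm'
      exact Finset.sum_eq_zero fun c' _ => (h1 m m' hm'.symm c c' t).resolve_left hc
  · push Not at h
    rw [Finset.sum_eq_zero fun m hm => Finset.sum_eq_zero fun c _ => h m hm c]
    exact zero_le_one

/-- An agent keeps its intensity with respect to the joint history of all agents. -/
lemma setLIntegral_meas_Ioc (hg : ∀ l, Measurable (g l)) (hN : IsMultiAgentHawkes Pr g N U A)
    (m : Fin M) (c : Fin C) {s t : ℝ} (hs : 0 ≤ s) (hst : s ≤ t) {E : Set Ω}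
    (hE : MeasurableSet[⨆ m, (N m).history s] E) :
    ∫⁻ ω in E, (N m).meas c ω (Ioc s t) ∂Pr =
      ∫⁻ ω in E, (∫⁻ u in Ioc s t, intensity (fun c => U c m) A g (N m) c u ω) ∂Pr := by
  have hind : Indep (N m).sigmaAlgebra (⨆ m' ∈ ({m}ᶜ : Set (Fin M)), (N m').sigmaAlgebra) Pr := by
    simpa using indep_iSup_of_disjoint (fun m => (N m).sigmaAlgebra_le) hN.iIndep_sigmaAlgebra
      (disjoint_compl_right (a := ({m} : Set (Fin M))))
  -- The history of agent `m` is enlarged by the full σ-algebras of all other agents, which contain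
  -- their histories up to `s`.
  refine setLIntegral_eq_of_indep (N m).sigmaAlgebra_le
    (iSup₂_le fun m' _ => (N m').sigmaAlgebra_le) ((N m).history_le s) hind
    ((N m).measurable_meas_apply measurableSet_Ioc)
    (measurable_setLIntegral_intensity hg (N m) c _)
    ((hN.hawkes m).lintegral_meas_Ioc_lt_top c s t).ne (fun E hE => ?_) (E := E) ?_
  · simpa only [(N m).count_sub_count c hst] using (hN.hawkes m).hasIntensity c s t hs hst E hE
  · refine (iSup_le fun m' => ?_ : (⨆ m, (N m).history s) ≤ _) E hE
    rcases eq_or_ne m' m with rfl | hm'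
    · exact le_sup_left
    · exact ((N m').history_le s).trans
        ((le_biSup (fun m' => (N m').sigmaAlgebra) (by simpa using hm')).trans le_sup_right)

theorem isHawkes_superpose [IsProbabilityMeasure Pr] (hg : ∀ l, Measurable (g l))
    (hN : IsMultiAgentHawkes Pr g N U A) (S : Finset (Fin M)) :
    IsHawkes Pr g (superpose N S) (fun c => ∑ m ∈ S, U c m) A where
  simple := hN.ae_superpose_singleton_le_one hg S
  finite_mean c t := by
    simp only [CountingProcess.count, superpose_meas, Measure.finsetSum_apply]
    rw [lintegral_finsetSum _ fun m _ => (N m).measurable_meas_coe measurableSet_Iic]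
    exact ENNReal.sum_lt_top.2 fun m _ => (hN.hawkes m).finite_mean c t
  hasIntensity c s t hs hst E hE := by
    -- The superposition forgets which agent produced an event, so its history is coarser than the
    -- joint one.
    have hE' : MeasurableSet[⨆ m, (N m).history s] E :=
      ((history_superpose_le N S s).trans (iSup₂_le_iSup _ _)) E hE
    have hu (ω : Ω) : ∫⁻ u in Ioc s t, intensity (fun c => ∑ m ∈ S, U c m) A g
          (superpose N S) c u ω =
        ∑ m ∈ S, ∫⁻ u in Ioc s t, intensity (fun c => U c m) A g (N m) c u ω := by
      refine (lintegral_congr fun u => intensity_superpose (fun m c => U c m) N S c u ω).trans ?_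
      exact lintegral_finsetSum _ fun m _ =>
        (measurable_intensity (μ := fun c => U c m) (A := A) hg (N m) c).comp
          measurable_prodMk_left
    simp_rw [hu, CountingProcess.count_sub_count _ c hst, superpose_meas, Measure.finsetSum_apply]
    rw [lintegral_finsetSum _ fun m _ => (N m).measurable_meas_coe measurableSet_Ioc,
      lintegral_finsetSum _ fun m _ =>
        (measurable_setLIntegral_intensity hg (N m) c _).mono (N m).sigmaAlgebra_le le_rfl]
    exact Finset.sum_congr rfl fun m _ => hN.setLIntegral_meas_Ioc hg m c hs hst hE'

/-- Superpositions over pairwise disjoint sets of agents are independent. -/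
lemma iIndepFun_superpose [IsProbabilityMeasure Pr] {κ : Type*} (hN : IsMultiAgentHawkes Pr g N U A)
    {S : κ → Finset (Fin M)} (hS : Pairwise fun j k => Disjoint (S j) (S k)) :
    iIndepFun (fun k ω c => (superpose N (S k)).meas c ω) Pr := by
  rw [iIndepFun_iff_iIndep]
  have := iIndep_biSup_of_pairwise_disjoint (fun m => (N m).sigmaAlgebra_le)
    hN.iIndep_sigmaAlgebra (S := fun k => (S k : Set (Fin M)))
    fun j k hjk => Finset.disjoint_coe.2 (hS hjk)
  rw [iIndep_iff] at this ⊢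
  intro s f hf
  refine this s fun k hk => (Measurable.comap_le ?_) _ (hf k hk)
  refine @measurable_pi_lambda _ _ _ (_) _ _ fun c =>
    @Measure.measurable_of_measurable_coe _ _ _ (_) _ fun B hB => ?_
  simp only [superpose_meas, Measure.finsetSum_apply]
  refine Finset.measurable_fun_sum _ fun m hm => ?_
  exact ((N m).measurable_meas_apply hB).mono
    (le_biSup (fun m => (N m).sigmaAlgebra) (Finset.mem_coe.2 hm)) le_rfl

end IsMultiAgentHawkes

end CountingProcess

end Hawkes

/-! ### The corollary -/

open Hawkes
theorem corollary1 {Ω : Type*} [MeasurableSpace Ω] (Pr : Measure Ω) [IsProbabilityMeasure Pr]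
    {C L M M' : ℕ} (g : Fin L → ℝ → ℝ≥0) (hg : ∀ l, Measurable (g l))
    (U : Matrix (Fin C) (Fin M) ℝ≥0) (A : Fin C → Fin C → Fin L → ℝ≥0)
    (N : Fin M → CountingProcess C Ω) (hN : IsMultiAgentHawkes Pr g N U A)
    (P : Matrix (Fin M) (Fin M') ℝ≥0) (hP : ∀ m m', P m m' = 0 ∨ P m m' = 1) :
    (∀ m', IsHawkes Pr g (superpose N {m | P m m' = 1}) (fun c => (U * P) c m') A) ∧
    ((∀ m, ∑ m', P m m' ≤ 1) →
      IsMultiAgentHawkes Pr g (fun m' => superpose N {m | P m m' = 1}) (U * P) A) := by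
  have hUP (m' : Fin M') (c : Fin C) :
      (U * P) c m' = ∑ m ∈ ({m | P m m' = 1} : Finset (Fin M)), U c m := by
    rw [Matrix.mul_apply, Finset.sum_filter]
    refine Finset.sum_congr rfl fun m _ => ?_
    rcases hP m m' with h | h <;> simp [h]
  have hHawkes : ∀ m', IsHawkes Pr g (superpose N {m | P m m' = 1}) (fun c => (U * P) c m') A := by
    intro m'
    simp_rw [hUP m']
    exact hN.isHawkes_superpose hg _
  refine ⟨hHawkes, fun hrow => ⟨hN.iIndepFun_superpose fun j k hjk => ?_, hHawkes⟩⟩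
  -- An agent used in two superpositions would have two ones in its row, giving `1 + 1 ≤ 1`.
  refine Finset.disjoint_left.2 fun m hj hk => ?_
  rw [Finset.mem_filter] at hj hk
  have h1 : ∑ m' ∈ {j, k}, P m m' ≤ 1 :=
    (Finset.sum_le_sum_of_subset (Finset.subset_univ _)).trans (hrow m)
  rw [Finset.sum_pair hjk, hj.2, hk.2] at h1
  norm_num at h1
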